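/- Let $K$ be a field of characteristic $0$, let $d$ be a natural number and let $(a_{ij})$ be a $d\times d$ matrix over $K$. Put $L_i=a_{i1}X_1+\dots+a_{id}X_d$, $H_i=L_i^3$ and $F_i=X_i+H_i$ in $K[X_1,\dots,X_d]$ for $1\le i\le d$, and let $F=(F_1,\dots,F_d):K^d\to K^d$ be the corresponding polynomial map. Let $JH=(\partial H_i/\partial X_j)_{1\le i,j\le d}$ be the Jacobian matrix of $H=(H_1,\dots,H_d)$. For each $i$ define polynomials $P_j^i\in K[X_1,\dots,X_d]$, $j\ge 0$, by $P_0^i=X_i$, $P_1^i=H_i$ and $$P_j^i(X_1,\dots,X_d)=P_{j-1}^i(F_1,\dots,F_d)-P_{j-1}^i(X_1,\dots,X_d)\qquad (j\ge 2).$$ If $(JH)^3=0$, then $F$ is invertible, i.e. there is a polynomial map $G=(G_1,\dots,G_d)$ with $G_i(F_1,\dots,F_d)=X_i$ for all $i$. This $G$ is unique, it also satisfies $F_i(G_1,\dots,G_d)=X_i$ for all $i$ (so $G=F^{-1}$), it is given by $$G_i(Y_1,\dots,Y_d)=Y_i-P_1^i(Y)+P_2^i(Y)-P_3^i(Y)+P_4^i(Y),\qquad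 1\le i\le d,$$ and $\deg F^{-1}=\max_i\deg G_i\le 9$. -/

import Mathlib

noncomputable section

/-- A polynomial map `K^d → K^d`, given by its `d` coordinate polynomials. -/
abbrev PolyMap (K : Type*) [CommSemiring K] (d : ℕ) : Type _ :=
  Fin d → MvPolynomial (Fin d) K

namespace PolyMap

variable {K : Type*} [Field K] {d : ℕ}

/-- The identity map `(X_1, …, X_d)`. -/
def id (K : Type*) [Field K] (d : ℕ) : PolyMap K d := fun i => MvPolynomial.X i

/-- The composition `G ∘ F`, with coordinates `G_i(F_1, …, F_d)`. -/
def comp (G F : PolyMap K d) : PolyMap K d := fun i => MvPolynomial.bind₁ F (G i)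

/-- `F` is invertible if some polynomial map `G` satisfies `G_i(F_1, …, F_d) = X_i` for all `i`. -/
def Invertible (F : PolyMap K d) : Prop := ∃ G : PolyMap K d, comp G F = id K d

/-- `deg F = max_i deg F_i`. -/
def degree (F : PolyMap K d) : ℕ := Finset.univ.sup fun i => (F i).totalDegree

/-- The Jacobian matrix `(∂ H_i / ∂ X_j)`. -/
def jacobian (H : PolyMap K d) : Matrix (Fin d) (Fin d) (MvPolynomial (Fin d) K) :=
  Matrix.of fun i j => MvPolynomial.pderiv j (H i)

/-- The linear form `L_i = a_{i1} X_1 + … + a_{id} X_d`. -/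
def linearForm (a : Matrix (Fin d) (Fin d) K) (i : Fin d) : MvPolynomial (Fin d) K :=
  ∑ j, MvPolynomial.C (a i j) * MvPolynomial.X j

/-- The map `H` with `H_i = L_i ^ 3`. -/
def cubeMap (a : Matrix (Fin d) (Fin d) K) : PolyMap K d := fun i => linearForm a i ^ 3

/-- The map `Id + H`. -/
def idAdd (H : PolyMap K d) : PolyMap K d := fun i => MvPolynomial.X i + H i

/-- The sequence of maps `P_j = (P_j^1, …, P_j^d)` attached to `F = Id + H`:
`P_0^i = X_i`, `P_1^i = H_i`, `P_j^i = P_{j-1}^i(F_1, …, F_d) - P_{j-1}^i`. -/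
def seqP (H : PolyMap K d) : ℕ → PolyMap K d
  | 0 => id K d
  | 1 => H
  | j + 2 => fun i => comp (seqP H (j + 1)) (idAdd H) i - seqP H (j + 1) i

end PolyMap

end

noncomputable section

namespace PolyMap

open MvPolynomial

variable {K : Type*} [Field K] {d : ℕ}

/-! Write h = A L³ and let D be the derivation with D X_j = L_j³, so that D L = h. Applying (JH)³ =
0 to the vector X gives A(L²h) = 0, that is, D h = 0. Differentiating this relation along D twice
more gives A(Lh²) = 0 and A(h³) = 0, hence A(L + ch)³ = h for every c. With c = 1, F sends L to L +
h and fixes h, so L - h pulls back to L and G = Y - (L - h)³ is a left inverse. With c = -1, G sends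
L to L - h, so G is also a right inverse. -/

/-- The image `A (L_1 ^ 3, …, L_d ^ 3)` of the cubic map under the matrix `A`. -/
def cubicImage (a : Matrix (Fin d) (Fin d) K) (i : Fin d) : MvPolynomial (Fin d) K :=
  ∑ j, C (a i j) * linearForm a j ^ 3

theorem pderiv_linearForm (a : Matrix (Fin d) (Fin d) K) (i j : Fin d) :
    pderiv j (linearForm a i) = C (a i j) := by
  simp [linearForm, pderiv_X, Pi.single_apply]

theorem eq_zero_of_linearForm_eq_zero {a : Matrix (Fin d) (Fin d) K} {i : Fin d}
    (h : linearForm a i = 0) (j : Fin d) : a i j = 0 := by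
  have := pderiv_linearForm a i j
  rw [h, map_zero] at this
  exact C_eq_zero.mp this.symm

theorem jacobian_cubeMap_mulVec (a : Matrix (Fin d) (Fin d) K)
    (v : Fin d → MvPolynomial (Fin d) K) (i : Fin d) :
    (jacobian (cubeMap a)).mulVec v i = 3 * linearForm a i ^ 2 * ∑ j, C (a i j) * v j := by
  simp only [Matrix.mulVec, dotProduct, jacobian, Matrix.of_apply, cubeMap, Finset.mul_sum]
  refine Finset.sum_congr rfl fun j _ => ?_
  rw [Derivation.leibniz_pow, pderiv_linearForm]
  simp only [nsmul_eq_mul, smul_eq_mul]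
  push_cast
  ring

/-- If the Jacobian of the cubic linear map has vanishing cube, then `A (L ^ 2 h) = 0`,
where `h = A L ^ 3`. -/
theorem sum_mul_sq_mul_cubicImage [CharZero K] {a : Matrix (Fin d) (Fin d) K}
    (hJ : jacobian (cubeMap a) ^ 3 = 0) (i : Fin d) :
    ∑ j, C (a i j) * (linearForm a j ^ 2 * cubicImage a j) = 0 := by
  -- The factor L_i² must be cancelled at the end; if L_i = 0, row i of A vanishes and the claim is
  -- trivial.
  by_cases hi : linearForm a i = 0
  · simp [eq_zero_of_linearForm_eq_zero hi]
  set J := jacobian (cubeMap a) with hJdef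
  have hX : J.mulVec X = fun i => 3 * linearForm a i ^ 3 := by
    funext k
    rw [hJdef, jacobian_cubeMap_mulVec]
    change 3 * linearForm a k ^ 2 * linearForm a k = _
    ring
  have hXX : J.mulVec (J.mulVec X) = fun i => 9 * (linearForm a i ^ 2 * cubicImage a i) := by
    funext k
    rw [hX, hJdef, jacobian_cubeMap_mulVec]
    simp only [mul_left_comm _ (3 : MvPolynomial (Fin d) K), ← Finset.mul_sum]
    rw [← cubicImage]
    ring
  have h0 : J.mulVec (J.mulVec (J.mulVec X)) i = 0 := by
    rw [Matrix.mulVec_mulVec, Matrix.mulVec_mulVec, mul_assoc, ← sq, ← pow_succ', hJ]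
    simp
  rw [hXX, hJdef, jacobian_cubeMap_mulVec] at h0
  simp only [mul_left_comm _ (9 : MvPolynomial (Fin d) K), ← Finset.mul_sum] at h0
  simpa [hi] using h0

/-- The derivation along the vector field `L ^ 3`. -/
def cubicDerivation (a : Matrix (Fin d) (Fin d) K) :
    Derivation K (MvPolynomial (Fin d) K) (MvPolynomial (Fin d) K) :=
  mkDerivation K fun j => linearForm a j ^ 3

theorem cubicDerivation_sum (a : Matrix (Fin d) (Fin d) K) (i : Fin d)
    (f : Fin d → MvPolynomial (Fin d) K) :
    cubicDerivation a (∑ j, C (a i j) * f j) = ∑ j, C (a i j) * cubicDerivation a (f j) := by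
  rw [map_sum]
  refine Finset.sum_congr rfl fun j _ => ?_
  rw [← smul_eq_C_mul, ← smul_eq_C_mul, Derivation.map_smul]

theorem cubicDerivation_linearForm (a : Matrix (Fin d) (Fin d) K) (i : Fin d) :
    cubicDerivation a (linearForm a i) = cubicImage a i := by
  rw [linearForm, cubicDerivation_sum]
  simp [cubicDerivation, cubicImage]

theorem cubicDerivation_cubicImage [CharZero K] {a : Matrix (Fin d) (Fin d) K}
    (hJ : jacobian (cubeMap a) ^ 3 = 0) (i : Fin d) :
    cubicDerivation a (cubicImage a i) = 0 := by
  rw [cubicImage, cubicDerivation_sum, ← mul_zero (3 : MvPolynomial (Fin d) K),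
    ← sum_mul_sq_mul_cubicImage hJ i, Finset.mul_sum]
  refine Finset.sum_congr rfl fun j _ => ?_
  rw [Derivation.leibniz_pow, cubicDerivation_linearForm]
  simp only [nsmul_eq_mul, smul_eq_mul]
  push_cast
  ring

/-- Since D L = h and D h = 0, D turns A(L²h) = 0 into 2A(Lh²) = 0. -/
theorem sum_mul_mul_cubicImage_sq [CharZero K] {a : Matrix (Fin d) (Fin d) K}
    (hJ : jacobian (cubeMap a) ^ 3 = 0) (i : Fin d) :
    ∑ j, C (a i j) * (linearForm a j * cubicImage a j ^ 2) = 0 := by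
  have h := congrArg (cubicDerivation a) (sum_mul_sq_mul_cubicImage hJ i)
  rw [cubicDerivation_sum, map_zero] at h
  have h2 : (2 : MvPolynomial (Fin d) K) *
      ∑ j, C (a i j) * (linearForm a j * cubicImage a j ^ 2) = 0 := by
    rw [← h, Finset.mul_sum]
    refine Finset.sum_congr rfl fun j _ => ?_
    rw [Derivation.leibniz, Derivation.leibniz_pow, cubicDerivation_linearForm,
      cubicDerivation_cubicImage hJ]
    simp only [nsmul_eq_mul, smul_eq_mul]
    push_cast
    ring
  simpa using h2

theorem sum_mul_cubicImage_cube [CharZero K] {a : Matrix (Fin d) (Fin d) K}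
    (hJ : jacobian (cubeMap a) ^ 3 = 0) (i : Fin d) :
    ∑ j, C (a i j) * cubicImage a j ^ 3 = 0 := by
  rw [← map_zero (cubicDerivation a), ← sum_mul_mul_cubicImage_sq hJ i, cubicDerivation_sum]
  refine Finset.sum_congr rfl fun j _ => ?_
  rw [Derivation.leibniz, Derivation.leibniz_pow, cubicDerivation_linearForm,
    cubicDerivation_cubicImage hJ]
  simp only [nsmul_eq_mul, smul_eq_mul]
  push_cast
  ring

/-- `A (L + c h) ^ 3 = A L ^ 3` for every scalar `c`. -/
theorem sum_mul_linearForm_add_cube [CharZero K] {a : Matrix (Fin d) (Fin d) K}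
    (hJ : jacobian (cubeMap a) ^ 3 = 0) (c : MvPolynomial (Fin d) K) (i : Fin d) :
    ∑ j, C (a i j) * (linearForm a j + c * cubicImage a j) ^ 3 = cubicImage a i := by
  have h : ∑ j, C (a i j) * (linearForm a j + c * cubicImage a j) ^ 3 = cubicImage a i +
      3 * c * (∑ j, C (a i j) * (linearForm a j ^ 2 * cubicImage a j)) +
      3 * c ^ 2 * (∑ j, C (a i j) * (linearForm a j * cubicImage a j ^ 2)) +
      c ^ 3 * (∑ j, C (a i j) * cubicImage a j ^ 3) := by
    simp only [cubicImage.eq_1 a i, Finset.mul_sum, ← Finset.sum_add_distrib]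
    refine Finset.sum_congr rfl fun j _ => ?_
    ring
  rw [h, sum_mul_sq_mul_cubicImage hJ, sum_mul_mul_cubicImage_sq hJ, sum_mul_cubicImage_cube hJ]
  ring

theorem bind₁_linearForm (a : Matrix (Fin d) (Fin d) K) (F : PolyMap K d) (i : Fin d) :
    bind₁ F (linearForm a i) = ∑ j, C (a i j) * F j := by
  simp [linearForm]

theorem bind₁_idAdd_linearForm (a : Matrix (Fin d) (Fin d) K) (i : Fin d) :
    bind₁ (idAdd (cubeMap a)) (linearForm a i) = linearForm a i + cubicImage a i := by
  simp only [bind₁_linearForm, idAdd, cubeMap, mul_add, Finset.sum_add_distrib]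
  rfl

theorem bind₁_idAdd_cubicImage [CharZero K] {a : Matrix (Fin d) (Fin d) K}
    (hJ : jacobian (cubeMap a) ^ 3 = 0) (i : Fin d) :
    bind₁ (idAdd (cubeMap a)) (cubicImage a i) = cubicImage a i := by
  conv_rhs => rw [← sum_mul_linearForm_add_cube hJ 1 i]
  simp [cubicImage.eq_1 a i, bind₁_idAdd_linearForm]

/-- The inverse `Y - (L - h) ^ 3` of the map `Id + L ^ 3`, where `h = A L ^ 3`. -/
def cubicInverse (a : Matrix (Fin d) (Fin d) K) : PolyMap K d :=
  fun i => X i - (linearForm a i - cubicImage a i) ^ 3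

theorem comp_cubicInverse_idAdd [CharZero K] {a : Matrix (Fin d) (Fin d) K}
    (hJ : jacobian (cubeMap a) ^ 3 = 0) :
    comp (cubicInverse a) (idAdd (cubeMap a)) = id K d := by
  funext i
  simp only [comp, cubicInverse, id, map_sub, map_pow, bind₁_X_right, bind₁_idAdd_linearForm,
    bind₁_idAdd_cubicImage hJ]
  simp [idAdd, cubeMap]

theorem bind₁_cubicInverse_linearForm [CharZero K] {a : Matrix (Fin d) (Fin d) K}
    (hJ : jacobian (cubeMap a) ^ 3 = 0) (i : Fin d) :
    bind₁ (cubicInverse a) (linearForm a i) = linearForm a i - cubicImage a i := by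
  rw [bind₁_linearForm]
  conv_rhs => rw [← sum_mul_linearForm_add_cube hJ (-1) i]
  simp only [cubicInverse, mul_sub, Finset.sum_sub_distrib, neg_one_mul, ← sub_eq_add_neg]
  rfl

theorem comp_idAdd_cubicInverse [CharZero K] {a : Matrix (Fin d) (Fin d) K}
    (hJ : jacobian (cubeMap a) ^ 3 = 0) :
    comp (idAdd (cubeMap a)) (cubicInverse a) = id K d := by
  funext i
  simp only [comp, idAdd, cubeMap, id, map_add, map_pow, bind₁_X_right,
    bind₁_cubicInverse_linearForm hJ]
  simp [cubicInverse]

theorem comp_assoc (P G F : PolyMap K d) : comp (comp P G) F = comp P (comp G F) := by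
  funext i
  exact bind₁_bind₁ _ _ _

theorem comp_id (F : PolyMap K d) : comp F (id K d) = F := by
  funext i
  exact DFunLike.congr_fun aeval_X_left (F i)

theorem id_comp (F : PolyMap K d) : comp (id K d) F = F := by
  funext i
  simp [comp, id]

theorem totalDegree_linearForm_le (a : Matrix (Fin d) (Fin d) K) (i : Fin d) :
    (linearForm a i).totalDegree ≤ 1 :=
  totalDegree_finsetSum_le fun j _ =>
    (totalDegree_mul _ _).trans (by simp)

theorem totalDegree_cubicImage_le (a : Matrix (Fin d) (Fin d) K) (i : Fin d) :
    (cubicImage a i).totalDegree ≤ 3 := by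
  refine totalDegree_finsetSum_le fun j _ => (totalDegree_mul _ _).trans ?_
  have h := totalDegree_pow (linearForm a j) 3
  have h' := totalDegree_linearForm_le a j
  rw [totalDegree_C]
  lia

theorem degree_cubicInverse_le (a : Matrix (Fin d) (Fin d) K) :
    (cubicInverse a).degree ≤ 9 := by
  refine Finset.sup_le fun i _ => (totalDegree_sub _ _).trans (max_le (by simp) ?_)
  have h := totalDegree_pow (linearForm a i - cubicImage a i) 3
  have h' := totalDegree_sub (linearForm a i) (cubicImage a i)
  have h₁ := totalDegree_linearForm_le a i
  have h₂ := totalDegree_cubicImage_le a i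
  have h₃ := max_le (h₁.trans (by norm_num)) h₂
  lia

/-- Composition with F acts on f(t) = (L + th)³ as t ↦ t + 1, so P_{k+1} is the k-th forward
difference of f at 0. Newton's formula gives f(-1) = P_1 - P_2 + P_3 - P_4, exact because f is cubic
in t. -/
theorem cubicInverse_eq_seqP [CharZero K] {a : Matrix (Fin d) (Fin d) K}
    (hJ : jacobian (cubeMap a) ^ 3 = 0) (i : Fin d) :
    cubicInverse a i = X i - seqP (cubeMap a) 1 i + seqP (cubeMap a) 2 i
      - seqP (cubeMap a) 3 i + seqP (cubeMap a) 4 i := by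
  have hcube : cubeMap a i = linearForm a i ^ 3 := rfl
  simp only [seqP, comp, hcube, map_sub, map_pow, map_add, bind₁_idAdd_linearForm,
    bind₁_idAdd_cubicImage hJ, cubicInverse]
  ring

end PolyMap

end

theorem theorem2 {K : Type*} [Field K] [CharZero K] (d : ℕ)
    (a : Matrix (Fin d) (Fin d) K) (H F : PolyMap K d)
    (hH : H = PolyMap.cubeMap a) (hF : F = PolyMap.idAdd H)
    (hJ : PolyMap.jacobian H ^ 3 = 0) :
    F.Invertible ∧
      ∃ G : PolyMap K d,
        (PolyMap.comp G F = PolyMap.id K d ∧ PolyMap.comp F G = PolyMap.id K d) ∧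
        (∀ G' : PolyMap K d, PolyMap.comp G' F = PolyMap.id K d → G' = G) ∧
        G.degree ≤ 9 ∧
        ∀ i, G i = MvPolynomial.X i - PolyMap.seqP H 1 i + PolyMap.seqP H 2 i
          - PolyMap.seqP H 3 i + PolyMap.seqP H 4 i := by
  subst hH hF
  have hGF := PolyMap.comp_cubicInverse_idAdd hJ
  have hFG := PolyMap.comp_idAdd_cubicInverse hJ
  refine ⟨⟨_, hGF⟩, PolyMap.cubicInverse a, ⟨hGF, hFG⟩, fun G' hG' => ?_,
    PolyMap.degree_cubicInverse_le a, PolyMap.cubicInverse_eq_seqP hJ⟩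
  -- A left inverse equals any right inverse: G' = G'∘(F∘G) = (G'∘F)∘G = G.
  rw [← PolyMap.comp_id G', ← hFG, ← PolyMap.comp_assoc, hG', PolyMap.id_comp]
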